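/- Throughout, $\widehat{\mathbb C}=\mathbb C\cup\{\infty\}$ is the Riemann sphere. A polynomial correspondence of degree $d$ is a polynomial $f_d(x,y)=\sum_{0\le i,j\le d}A_{(i,j)}x^iy^j\in\mathbb C[x,y]$ such that the zero set $\Gamma_{f_d}\subset\widehat{\mathbb C}\times\widehat{\mathbb C}$ of its bihomogenisation in bidegree $(d,d)$ contains no component $\{a\}\times\widehat{\mathbb C}$ or $\widehat{\mathbb C}\times\{a\}$, $a\in\widehat{\mathbb C}$. For $x_1\in\widehat{\mathbb C}$ let $Y(x_1)$ be the multiset of the $d$ points $y$ with $(x_1,y)\in\Gamma_{f_d}$, and for $y_1\in\widehat{\mathbb C}$ let $X(y_1)$ be the multiset of the $d$ points $x$ with $(x,y_1)\in\Gamma_{f_d}$, both repeated according to intersection multiplicity (multiplicity as zeros of the restricted form). The correspondence $f_d$ is called a map of $d$-tuples if for every $x_1\in\widehat{\mathbb C}$ the multisets $X(y)$, $y\in Y(x_1)$, all coincide, and for every $y_1\in\widehat{\mathbb C}$ the multisets $Y(x)$, $x\in X(y_1)$, all coincide. (The same definition is used for every degree $k\ge 1$.) **Theorem 2.6.** Let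 $d\ge 2$ and let $f_d$ be a map of $d$-tuples that cannot be written as $f_d=[g_k]^{d/k}$ with $k\mid d$, $k\ne d$ and $g_k\in\mathbb C[x,y]$ a map of $k$-tuples. Then the following statements are equivalent. 1. For all $x,y\in\mathbb C$: $f_d(x,y)=0$ if and only if $f_d(\overline x,\overline y)=0$. 2. There are rational functions of degree $d$, $$\Phi(x)=\frac{\kappa_dx^d+\cdots+\kappa_1x+\kappa_0}{\lambda_dx^d+\cdots+\lambda_1x+\lambda_0},\qquad \Psi(y)=\frac{\mu_dy^d+\cdots+\mu_1y+\mu_0}{\nu_dy^d+\cdots+\nu_1y+\nu_0}$$ (numerator and denominator coprime, the larger of their degrees equal to $d$), with all coefficients $\kappa_i,\lambda_i,\mu_i,\nu_i$ real, such that the equation $f_d(x,y)=0$ can be rewritten as $\Phi(x)=\Psi(y)$, i.e. for all $x,y\in\widehat{\mathbb C}$: $(x,y)\in\Gamma_{f_d}$ if and only if $\Phi(x)=\Psi(y)$ in $\widehat{\mathbb C}$. 3. The $(d+1)\times(d+1)$ matrix of coefficients $\big(A_{(d-i,\,d-j)}\big)_{0\le i,j\le d}$ is real up to multiplication by a constant,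 i.e. it equals $cB$ for some $c\in\mathbb C\setminus\{0\}$ and some real matrix $B$. -/

import Mathlib

open scoped Polynomial.Bivariate

noncomputable section

namespace TupleMap

open Polynomial

/- The Riemann sphere is `OnePoint ℂ`. An element `f` of `ℂ[X][Y]` is a polynomial in `x, y`:
the coefficient of `x ^ i * y ^ j` is `(f.coeff j).coeff i`, its value at `(x, y)` is
`f.evalEval x y`. -/

/-- The matrix of coefficients of `f`: row `i` and column `j` hold `A_(d-i, d-j)`, where `A_(p, q)`
is the coefficient of `x ^ p * y ^ q`. -/
def coeffMatrix (d : ℕ) (f : ℂ[X][Y]) : Matrix (Fin (d + 1)) (Fin (d + 1)) ℂ :=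
  fun i j => (f.coeff (d - (j : ℕ))).coeff (d - (i : ℕ))

/-- A polynomial `p` of degree at most `d` is regarded as a form of degree `d` in two variables
`(ξ, x)`; this is its value at the representative `(1, a)` of a finite point `a`, and at the
representative `(0, 1)` of `∞`. -/
def formEval (d : ℕ) (p : ℂ[X]) : OnePoint ℂ → ℂ
  | none => p.coeff d
  | some a => p.eval a

/-- The zeros on the sphere of a nonzero polynomial of degree at most `d`, regarded as a form of
degree `d`, repeated according to multiplicity (`d` points in all). -/
def zeros (d : ℕ) (p : ℂ[X]) : Multiset (OnePoint ℂ) :=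
  p.roots.map (fun a : ℂ => (a : OnePoint ℂ)) + Multiset.replicate (d - p.natDegree) OnePoint.infty

/-- The restriction of the bihomogenisation of `f` (in bidegree `(d, d)`) to `{a} × sphere`,
a polynomial in `y`: it is `f (a, y)` for finite `a`, and the coefficient of `x ^ d` for `∞`. -/
def sectionX (d : ℕ) (f : ℂ[X][Y]) : OnePoint ℂ → ℂ[X]
  | none => ∑ j ∈ Finset.range (d + 1), C ((f.coeff j).coeff d) * X ^ j
  | some a => f.map (evalRingHom a)

/-- The restriction of the bihomogenisation of `f` (in bidegree `(d, d)`) to `sphere × {b}`,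
a polynomial in `x`: it is `f (x, b)` for finite `b`, and the coefficient of `y ^ d` for `∞`. -/
def sectionY (d : ℕ) (f : ℂ[X][Y]) : OnePoint ℂ → ℂ[X]
  | none => f.coeff d
  | some b => f.eval (C b)

/-- `f` is a polynomial correspondence of degree `d`: it has degree at most `d` in each variable and
its biprojective completion contains no `{a} × sphere` and no `sphere × {b}`, with `a`, `b` finite
or `∞`. (In particular every point then has exactly `d` images and `d` preimages, counted with
multiplicity.) -/
structure IsCorrespondence (d : ℕ) (f : ℂ[X][Y]) : Prop where
  natDegree_y_le : f.natDegree ≤ d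
  natDegree_x_le : ∀ j, (f.coeff j).natDegree ≤ d
  sectionX_ne_zero : ∀ a : OnePoint ℂ, sectionX d f a ≠ 0
  sectionY_ne_zero : ∀ b : OnePoint ℂ, sectionY d f b ≠ 0

/-- The biprojective completion in `sphere × sphere` of the curve `f = 0`: the zero set of the
bihomogenisation of `f` in bidegree `(d, d)`. -/
def completion (d : ℕ) (f : ℂ[X][Y]) : Set (OnePoint ℂ × OnePoint ℂ) :=
  {p | formEval d (sectionX d f p.1) p.2 = 0}

/-- The points `y` with `(x, y)` on the completed curve, repeated according to intersection
multiplicity. -/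
def image (d : ℕ) (f : ℂ[X][Y]) (x : OnePoint ℂ) : Multiset (OnePoint ℂ) :=
  zeros d (sectionX d f x)

/-- The points `x` with `(x, y)` on the completed curve, repeated according to intersection
multiplicity. -/
def preimage (d : ℕ) (f : ℂ[X][Y]) (y : OnePoint ℂ) : Multiset (OnePoint ℂ) :=
  zeros d (sectionY d f y)

/-- `f` is a map of `d`-tuples. -/
structure IsMapOfTuples (d : ℕ) (f : ℂ[X][Y]) : Prop extends IsCorrespondence d f where
  preimage_eq : ∀ x : OnePoint ℂ, ∀ y ∈ image d f x, ∀ y' ∈ image d f x,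
    preimage d f y = preimage d f y'
  image_eq : ∀ y : OnePoint ℂ, ∀ x ∈ preimage d f y, ∀ x' ∈ preimage d f y,
    image d f x = image d f x'

/-- `f = g ^ (d / k)` for a proper divisor `k` of `d` and a map `g` of `k`-tuples. -/
def IsProperPower (d : ℕ) (f : ℂ[X][Y]) : Prop :=
  ∃ (k : ℕ) (g : ℂ[X][Y]), k ∣ d ∧ k ≠ d ∧ IsMapOfTuples k g ∧ f = g ^ (d / k)

/-- The fraction `P / Q` is a rational function of degree `d`. -/
def IsFractionOfDegree (d : ℕ) (P Q : ℂ[X]) : Prop :=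
  IsCoprime P Q ∧ max P.natDegree Q.natDegree = d

/-- The self-map of the sphere given by the fraction `P / Q` of degree `d`. -/
def fracMap (d : ℕ) (P Q : ℂ[X]) (x : OnePoint ℂ) : OnePoint ℂ :=
  open Classical in
  if formEval d Q x = 0 then OnePoint.infty
  else ((formEval d P x / formEval d Q x : ℂ) : OnePoint ℂ)

/-- The equation `f (x, y) = 0` can be rewritten, on the product of spheres, as `Φ x = Ψ y` with
`Φ = K / L` and `Ψ = M / N` fractions of degree `d`. -/
def IsSeparation (d : ℕ) (f : ℂ[X][Y]) (K L M N : ℂ[X]) : Prop :=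
  IsFractionOfDegree d K L ∧ IsFractionOfDegree d M N ∧
    ∀ x y : OnePoint ℂ, (x, y) ∈ completion d f ↔ fracMap d K L x = fracMap d M N y

/-- All coefficients of `p` are real. -/
def HasRealCoeffs (p : ℂ[X]) : Prop := ∀ i, (p.coeff i).im = 0

end TupleMap

end

namespace TupleMap

open Polynomial Filter ComplexConjugate

/-! The implications run 1 → 3 → 2 → 1, and the last is immediate by conjugating `K(x) N(y) = L(x)
M(y)`. The hypothesis on powers enters through squarefreeness. For a map of tuples all irreducible
factors of `f` have the same exponent `m` (`IsMapOfTuples.multiplicity_eq`), so `f = g ^ m` with `g`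
squarefree. Since `g` is again a map of tuples, `m = 1`. Hence all but finitely many sections of `f`
in either direction have `d` distinct finite roots. 1 → 3: the conjugate polynomial vanishes
wherever `f` does. Comparing generic sections makes it a constant multiple of `f`
(`IsMapOfTuples.exists_eq_C_mul`), so dividing `f` by one nonzero coefficient makes it real. 3 → 2:
two points of one fibre have proportional sections. If `f(x₁, y₁) = f(x₂, y₂) = 0` and the two
fibres are distinct, interpolation writes `f(x, y)` as a combination of `f(x, y₁) f(x₂, y)` and
`f(x, y₂) f(x₁, y)` (`IsMapOfTuples.evalEval_mul_eq`), which separates the variables. With `y₁`,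
`y₂` real the factors in `x` are real up to the common constant, and this forces the factors in `y`
to be real too. -/

/-! ### Generic sections of primitive squarefree polynomials -/

theorem isCoprime_map_algebraMap {R : Type*} [CommRing R] [IsDomain R]
    [UniqueFactorizationMonoid R] (K : Type*) [Field K] [Algebra R K] [IsFractionRing R K]
    (A B : R[X]) (hA : A.IsPrimitive) (h : IsRelPrime A B) :
    IsCoprime (A.map (algebraMap R K)) (B.map (algebraMap R K)) := by
  induction A using UniqueFactorizationMonoid.induction_on_prime with
  | h₁ => exact absurd rfl hA.ne_zero
  | h₂ u hu =>
    obtain ⟨v, hv⟩ := (hu.map (mapRingHom (algebraMap R K))).exists_left_inv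
    exact ⟨v, 0, by rw [zero_mul, add_zero]; exact hv⟩
  | h₃ a p ha hp ih =>
    have hpp : p.IsPrimitive := isPrimitive_of_dvd hA (dvd_mul_right p a)
    rw [Polynomial.map_mul]
    refine IsCoprime.mul_left ?_
      (ih (isPrimitive_of_dvd hA (dvd_mul_left a p)) (h.of_mul_left_right))
    -- Gauss's lemma: a primitive irreducible polynomial stays irreducible over the fraction field.
    have hirr := (hpp.irreducible_iff_irreducible_map_fraction_map (K := K)).1 hp.irreducible
    refine (hirr.coprime_iff_not_dvd).2 fun hd => ?_
    have hpB : p ∣ B := hpp.dvd_of_fraction_map_dvd_fraction_map hd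
    exact hp.not_isUnit (h (dvd_mul_right p a) hpB)

/-- Clears denominators in a Bézout relation over the fraction field. For `R = ℂ[X]` the relation
can then be specialised at every `x` that is not a root of `r`. -/
theorem exists_bezout {R : Type*} [CommRing R] [IsDomain R] [UniqueFactorizationMonoid R]
    (A B : R[X]) (hA : A.IsPrimitive) (h : IsRelPrime A B) :
    ∃ r : R, r ≠ 0 ∧ ∃ u v : R[X], u * A + v * B = C r := by
  obtain ⟨u, v, huv⟩ := isCoprime_map_algebraMap (FractionRing R) A B hA h
  obtain ⟨b, hb, hu⟩ := IsLocalization.integerNormalization_spec (nonZeroDivisors R) u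
  obtain ⟨c, hc, hv⟩ := IsLocalization.integerNormalization_spec (nonZeroDivisors R) v
  refine ⟨b * c, mul_ne_zero (nonZeroDivisors.ne_zero hb) (nonZeroDivisors.ne_zero hc),
    C c * IsLocalization.integerNormalization (nonZeroDivisors R) u,
    C b * IsLocalization.integerNormalization (nonZeroDivisors R) v, ?_⟩
  apply Polynomial.map_injective _ (IsFractionRing.injective R (FractionRing R))
  simp only [Polynomial.map_add, Polynomial.map_mul, map_C, hu, hv, map_mul,
    Algebra.smul_def, Polynomial.algebraMap_apply]
  linear_combination (C (algebraMap R (FractionRing R) b) * C (algebraMap R (FractionRing R) c)) * huv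

theorem eventually_eval_ne_zero {r : ℂ[X]} (hr : r ≠ 0) : ∀ᶠ x in cofinite, r.eval x ≠ 0 := by
  refine (r.roots.toFinset.finite_toSet).subset fun x hx => ?_
  simp_all

theorem eventually_isCoprime_map_evalRingHom {A B : ℂ[X][Y]} (hA : A.IsPrimitive)
    (h : IsRelPrime A B) :
    ∀ᶠ x in cofinite, IsCoprime (A.map (evalRingHom x)) (B.map (evalRingHom x)) := by
  obtain ⟨r, hr, u, v, huv⟩ := exists_bezout A B hA h
  filter_upwards [eventually_eval_ne_zero hr] with x hx
  have := congrArg (Polynomial.map (evalRingHom x)) huv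
  simp only [Polynomial.map_add, Polynomial.map_mul, map_C, coe_evalRingHom] at this
  refine ⟨C (r.eval x)⁻¹ * u.map (evalRingHom x), C (r.eval x)⁻¹ * v.map (evalRingHom x), ?_⟩
  rw [mul_assoc, mul_assoc, ← mul_add, this, ← C_mul, inv_mul_cancel₀ hx, C_1]

theorem natDegree_pos_of_dvd_isPrimitive {R : Type*} [CommRing R] [IsDomain R] {f p : R[X]}
    (hf : f.IsPrimitive) (hp : Irreducible p) (h : p ∣ f) : 0 < p.natDegree := by
  by_contra h0
  have hc := eq_C_of_natDegree_eq_zero (Nat.eq_zero_of_not_pos h0)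
  rw [hc] at h hp
  exact hp.not_isUnit ((hf _ h).map C)

/-- If an irreducible `p` divides `f = p * s` and its derivative, then `p` divides `p' * s`.
Primitivity gives `p` positive degree in `y`, so `p'` is nonzero of smaller degree; hence `p ∣ s`,
against squarefreeness. -/
theorem isRelPrime_derivative {f : ℂ[X][Y]} (hf : f.IsPrimitive) (hs : Squarefree f) :
    IsRelPrime f (derivative f) := by
  refine WfDvdMonoid.isRelPrime_of_no_irreducible_factors (fun h => hf.ne_zero h.1) ?_
  rintro p hp ⟨s, rfl⟩ hd
  have hpos := natDegree_pos_of_dvd_isPrimitive hf hp (dvd_mul_right p s)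
  rw [derivative_mul, dvd_add_left (dvd_mul_right p _)] at hd
  rcases hp.prime.dvd_or_dvd hd with h | h
  · have h0 : derivative p ≠ 0 := fun h0 =>
      hpos.ne' (derivative_eq_zero.1 h0)
    exact absurd (natDegree_le_of_dvd h h0) (not_le.2 (natDegree_derivative_lt hpos.ne'))
  · exact hp.not_isUnit (hs p (mul_dvd_mul_left p h))

theorem eventually_separable {f : ℂ[X][Y]} (hf : f.IsPrimitive) (hs : Squarefree f) :
    ∀ᶠ x in cofinite, (f.map (evalRingHom x)).Separable := by
  filter_upwards [eventually_isCoprime_map_evalRingHom hf (isRelPrime_derivative hf hs)] with x hx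
  rwa [Separable, derivative_map]

theorem eventually_natDegree_map {f : ℂ[X][Y]} (hf : f ≠ 0) :
    ∀ᶠ x in cofinite, (f.map (evalRingHom x)).natDegree = f.natDegree := by
  filter_upwards [eventually_eval_ne_zero (leadingCoeff_ne_zero.2 hf)] with x hx
  exact natDegree_map_of_leadingCoeff_ne_zero _ hx

theorem ext_evalEval {f g : ℂ[X][Y]} (h : ∀ᶠ x in cofinite, ∀ y, f.evalEval x y = g.evalEval x y) :
    f = g := by
  ext1 n
  refine eq_of_infinite_eval_eq _ _ (frequently_cofinite_iff_infinite.1 (h.frequently.mono fun x hx => ?_))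
  have : f.map (evalRingHom x) = g.map (evalRingHom x) := by
    refine Polynomial.funext fun y => ?_
    simpa only [map_evalRingHom_eval] using hx y
  simpa using congrArg (fun p => p.coeff n) this

/-! ### Exchange of the two variables -/

theorem coeff_coeff_swap (f : ℂ[X][Y]) (i j : ℕ) :
    ((Bivariate.swap f).coeff i).coeff j = (f.coeff j).coeff i := by
  induction f using Polynomial.induction_on' with
  | add p q hp hq => simp [hp, hq]
  | monomial n a =>
    induction a using Polynomial.induction_on' with
    | add p q hp hq => simp only [map_add, coeff_add, hp, hq]
    | monomial m r =>
      rw [Bivariate.swap_monomial_monomial]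
      simp only [coeff_monomial]
      split_ifs <;> simp_all [coeff_monomial]

theorem evalEval_swap (f : ℂ[X][Y]) (x y : ℂ) :
    (Bivariate.swap f).evalEval x y = f.evalEval y x := by
  simpa only [coe_aevalAeval_eq_evalEval] using Bivariate.aevalAeval_swap x y f

theorem natDegree_swap_le {d : ℕ} {f : ℂ[X][Y]} (h : ∀ j, (f.coeff j).natDegree ≤ d) :
    (Bivariate.swap f).natDegree ≤ d := by
  refine natDegree_le_iff_coeff_eq_zero.2 fun i hi => ?_
  ext j
  rw [coeff_coeff_swap, coeff_zero]
  exact coeff_eq_zero_of_natDegree_lt ((h j).trans_lt hi)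

theorem natDegree_coeff_swap_le {d : ℕ} {f : ℂ[X][Y]} (h : f.natDegree ≤ d) (j : ℕ) :
    ((Bivariate.swap f).coeff j).natDegree ≤ d := by
  refine natDegree_le_iff_coeff_eq_zero.2 fun i hi => ?_
  rw [coeff_coeff_swap, coeff_eq_zero_of_natDegree_lt (h.trans_lt hi), coeff_zero]

theorem sectionX_infty {d : ℕ} {f : ℂ[X][Y]} (h : f.natDegree ≤ d) :
    sectionX d f none = (Bivariate.swap f).coeff d := by
  rw [as_sum_range' ((Bivariate.swap f).coeff d) (d + 1)
    (Nat.lt_succ_of_le (natDegree_coeff_swap_le h d))]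
  simp only [sectionX, coeff_coeff_swap, C_mul_X_pow_eq_monomial]

theorem sectionX_swap {d : ℕ} {f : ℂ[X][Y]} (h : ∀ j, (f.coeff j).natDegree ≤ d)
    (b : OnePoint ℂ) : sectionX d (Bivariate.swap f) b = sectionY d f b := by
  cases b with
  | infty =>
    refine (sectionX_infty (natDegree_swap_le h)).trans ?_
    rw [Bivariate.swap_swap_apply]
    rfl
  | coe b =>
    refine Polynomial.funext fun x => ?_
    change ((Bivariate.swap f).map (evalRingHom b)).eval x = f.evalEval x b
    rw [map_evalRingHom_eval, evalEval_swap]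

theorem sectionY_swap {d : ℕ} {f : ℂ[X][Y]} (h : f.natDegree ≤ d)
    (b : OnePoint ℂ) : sectionY d (Bivariate.swap f) b = sectionX d f b := by
  rw [← sectionX_swap (natDegree_coeff_swap_le h), Bivariate.swap_swap_apply]

theorem IsCorrespondence.swap {d : ℕ} {f : ℂ[X][Y]} (hf : IsCorrespondence d f) :
    IsCorrespondence d (Bivariate.swap f) where
  natDegree_y_le := natDegree_swap_le hf.natDegree_x_le
  natDegree_x_le := natDegree_coeff_swap_le hf.natDegree_y_le
  sectionX_ne_zero a := by
    rw [sectionX_swap hf.natDegree_x_le]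
    exact hf.sectionY_ne_zero a
  sectionY_ne_zero a := by
    rw [sectionY_swap hf.natDegree_y_le]
    exact hf.sectionX_ne_zero a

theorem IsCorrespondence.image_swap {d : ℕ} {f : ℂ[X][Y]} (hf : IsCorrespondence d f) :
    image d (Bivariate.swap f) = preimage d f := by
  funext b
  rw [image, preimage, sectionX_swap hf.natDegree_x_le]

theorem IsCorrespondence.preimage_swap {d : ℕ} {f : ℂ[X][Y]} (hf : IsCorrespondence d f) :
    preimage d (Bivariate.swap f) = image d f := by
  funext b
  rw [image, preimage, sectionY_swap hf.natDegree_y_le]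

theorem IsMapOfTuples.swap {d : ℕ} {f : ℂ[X][Y]} (hf : IsMapOfTuples d f) :
    IsMapOfTuples d (Bivariate.swap f) where
  toIsCorrespondence := hf.toIsCorrespondence.swap
  preimage_eq := by
    rw [hf.preimage_swap, hf.image_swap]
    exact hf.image_eq
  image_eq := by
    rw [hf.preimage_swap, hf.image_swap]
    exact hf.preimage_eq

/-! ### Degree, primitivity and fibres of a correspondence -/

theorem IsCorrespondence.natDegree_eq {d : ℕ} {f : ℂ[X][Y]} (hf : IsCorrespondence d f) :
    f.natDegree = d :=
  le_antisymm hf.natDegree_y_le (le_natDegree_of_ne_zero (hf.sectionY_ne_zero none))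

theorem IsCorrespondence.ne_zero {d : ℕ} {f : ℂ[X][Y]} (hf : IsCorrespondence d f) : f ≠ 0 := by
  rintro rfl
  exact hf.sectionY_ne_zero none rfl

/-- A root `a` of a nonconstant factor `r(x)` would make `{a} × sphere` a component. -/
theorem IsCorrespondence.isPrimitive {d : ℕ} {f : ℂ[X][Y]} (hf : IsCorrespondence d f) :
    f.IsPrimitive := by
  rintro r ⟨s, rfl⟩
  by_contra hr
  have hr0 : r ≠ 0 := by
    rintro rfl
    exact hf.ne_zero (by simp)
  obtain ⟨a, ha⟩ := IsAlgClosed.exists_root r fun h => hr (isUnit_iff_degree_eq_zero.2 h)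
  refine hf.sectionX_ne_zero a ?_
  change (C r * s).map (evalRingHom a) = 0
  simp [Polynomial.map_mul, ha.eq_zero]

theorem count_coe_zeros [DecidableEq (OnePoint ℂ)] (d : ℕ) (p : ℂ[X]) (a : ℂ) :
    (zeros d p).count (a : OnePoint ℂ) = p.rootMultiplicity a := by
  classical
  rw [zeros, Multiset.count_add, Multiset.count_replicate,
    Multiset.count_map_eq_count' _ _ (OnePoint.coe_injective), count_roots,
    if_neg (OnePoint.infty_ne_coe a), add_zero]

theorem coe_mem_zeros {d : ℕ} {p : ℂ[X]} (hp : p ≠ 0) {a : ℂ} :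
    (a : OnePoint ℂ) ∈ zeros d p ↔ p.eval a = 0 := by
  classical
  rw [← Multiset.count_pos, count_coe_zeros, rootMultiplicity_pos hp, IsRoot.def]

theorem IsCorrespondence.coe_mem_image {d : ℕ} {f : ℂ[X][Y]} (hf : IsCorrespondence d f)
    {x y : ℂ} : (y : OnePoint ℂ) ∈ image d f x ↔ f.evalEval x y = 0 := by
  rw [image, coe_mem_zeros (hf.sectionX_ne_zero x), ← map_evalRingHom_eval]
  rfl

theorem IsCorrespondence.coe_mem_preimage {d : ℕ} {f : ℂ[X][Y]} (hf : IsCorrespondence d f)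
    {x y : ℂ} : (x : OnePoint ℂ) ∈ preimage d f y ↔ f.evalEval x y = 0 := by
  rw [preimage, coe_mem_zeros (hf.sectionY_ne_zero y)]
  rfl

/-! ### Equality of the exponents of the irreducible factors -/

theorem eventually_exists_root {f p : ℂ[X][Y]} (hf : f.IsPrimitive) (hp : Irreducible p)
    (h : p ∣ f) : ∀ᶠ x in cofinite, ∃ y, p.evalEval x y = 0 := by
  filter_upwards [eventually_natDegree_map hp.ne_zero] with x hx
  obtain ⟨y, hy⟩ := IsAlgClosed.exists_root (p.map (evalRingHom x)) fun h0 => by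
    have := natDegree_pos_of_dvd_isPrimitive hf hp h
    exact this.ne' (hx.symm.trans (natDegree_eq_of_degree_eq_some h0))
  exact ⟨y, by rw [← map_evalRingHom_eval]; exact hy⟩

/-- For generic `x`, the roots of `p(x, ·)` are simple and none is a root of `q(x, ·)`. -/
theorem IsCorrespondence.eventually_count_image [DecidableEq (OnePoint ℂ)] {d m : ℕ}
    {f p q : ℂ[X][Y]} (hf : IsCorrespondence d f) (hp : Irreducible p) (hm : m ≠ 0) (hq : ¬ p ∣ q)
    (h : f = p ^ m * q) :
    ∀ᶠ x in cofinite, ∀ y : ℂ, p.evalEval x y = 0 →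
      (image d f x).count (y : OnePoint ℂ) = m := by
  have hpf : p ∣ f := h ▸ (dvd_pow_self p hm).mul_right q
  have hpp := isPrimitive_of_dvd hf.isPrimitive hpf
  filter_upwards [eventually_separable hpp hp.squarefree,
    eventually_isCoprime_map_evalRingHom hpp ((hp.dvd_or_isRelPrime).resolve_left hq)]
    with x hsep hcop y hy
  rw [← map_evalRingHom_eval] at hy
  have hx : f.map (evalRingHom x) ≠ 0 := hf.sectionX_ne_zero x
  have hqy : ¬ (q.map (evalRingHom x)).IsRoot y := fun hqy => by
    obtain ⟨u, v, huv⟩ := hcop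
    have := congrArg (Polynomial.eval y) huv
    simp only [eval_add, eval_mul, hy, hqy.eq_zero] at this
    simp at this
  have hp1 : (p.map (evalRingHom x)).rootMultiplicity y = 1 := by
    refine le_antisymm (rootMultiplicity_le_one_of_separable hsep y) ?_
    exact (rootMultiplicity_pos hsep.ne_zero).2 hy
  rw [image, count_coe_zeros]
  change (f.map (evalRingHom x)).rootMultiplicity y = m
  rw [h, Polynomial.map_mul, Polynomial.map_pow] at hx ⊢
  classical
  rw [rootMultiplicity_mul hx, ← count_roots, roots_pow, Multiset.count_nsmul, count_roots, hp1,
    rootMultiplicity_eq_zero hqy, mul_one, add_zero]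

theorem IsCorrespondence.eventually_count_preimage [DecidableEq (OnePoint ℂ)] {d m : ℕ}
    {f p q : ℂ[X][Y]} (hf : IsCorrespondence d f) (hp : Irreducible p) (hm : m ≠ 0) (hq : ¬ p ∣ q)
    (h : f = p ^ m * q) :
    ∀ᶠ y in cofinite, ∀ x : ℂ, p.evalEval x y = 0 →
      (preimage d f y).count (x : OnePoint ℂ) = m := by
  have := hf.swap.eventually_count_image
    ((MulEquiv.irreducible_iff (Bivariate.swap (R := ℂ))).2 hp) hm
    (fun h => hq ((map_dvd_iff (Bivariate.swap (R := ℂ))).1 h)) (by rw [h, map_mul, map_pow])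
  simpa only [evalEval_swap, hf.image_swap] using this

/-- Each of the finitely many bad `y` lies over finitely many `x` only, because `f(·, y)` is not
zero. -/
theorem IsCorrespondence.eventually_forall_image {d : ℕ} {f : ℂ[X][Y]}
    (hf : IsCorrespondence d f) {P : ℂ → Prop} (hP : ∀ᶠ y in cofinite, P y) :
    ∀ᶠ x in cofinite, ∀ y, f.evalEval x y = 0 → P y := by
  have : ∀ᶠ x in cofinite, ∀ y ∈ {y | ¬ P y}, f.evalEval x y ≠ 0 :=
    (eventually_all_finite hP).2 fun y _ => eventually_eval_ne_zero (hf.sectionY_ne_zero y)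
  filter_upwards [this] with x hx y hy
  by_contra h
  exact hx y h hy

/-- Over a generic `x` take `y` on `p = 0` and `y'` on `p' = 0`. The multisets `X(y)` and `X(y')`
coincide, and `x` occurs `m` times in the first and `n` times in the second. -/
theorem IsMapOfTuples.multiplicity_eq {d m n : ℕ} {f p q p' q' : ℂ[X][Y]}
    (hf : IsMapOfTuples d f) (hp : Irreducible p) (hm : m ≠ 0) (hq : ¬ p ∣ q)
    (h : f = p ^ m * q) (hp' : Irreducible p') (hn : n ≠ 0) (hq' : ¬ p' ∣ q')
    (h' : f = p' ^ n * q') : m = n := by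
  classical
  have hpf : p ∣ f := h ▸ (dvd_pow_self p hm).mul_right q
  have hpf' : p' ∣ f := h' ▸ (dvd_pow_self p' hn).mul_right q'
  obtain ⟨x, ⟨y, hy⟩, ⟨y', hy'⟩, hc, hc'⟩ :=
    ((eventually_exists_root hf.isPrimitive hp hpf).and
    ((eventually_exists_root hf.isPrimitive hp' hpf').and
    ((hf.eventually_forall_image (hf.eventually_count_preimage hp hm hq h)).and
    (hf.eventually_forall_image (hf.eventually_count_preimage hp' hn hq' h'))))).exists
  have hfy : f.evalEval x y = 0 := zero_dvd_iff.1 (hy ▸ evalEval_dvd x y hpf)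
  have hfy' : f.evalEval x y' = 0 := zero_dvd_iff.1 (hy' ▸ evalEval_dvd x y' hpf')
  rw [← hc y hfy x hy, ← hc' y' hfy' x hy',
    hf.preimage_eq x y (hf.coe_mem_image.2 hfy) y' (hf.coe_mem_image.2 hfy')]

theorem exists_squarefree_pow_associated {R : Type*} [CommMonoidWithZero R]
    [UniqueFactorizationMonoid R] {f : R} (hf : f ≠ 0) {m : ℕ}
    (h : ∀ (p q : R) (n : ℕ), Irreducible p → n ≠ 0 → ¬ p ∣ q → f = p ^ n * q → n = m) :
    ∃ g : R, Squarefree g ∧ Associated (g ^ m) f := by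
  classical
  let : StrongNormalizationMonoid R := UniqueFactorizationMonoid.strongNormalizationMonoid
  set s := UniqueFactorizationMonoid.normalizedFactors f with hs
  have hirr : ∀ p ∈ s, Irreducible p := fun p hp =>
    UniqueFactorizationMonoid.irreducible_of_normalized_factor p hp
  have hsm : s = m • s.dedup := by
    ext p
    rw [Multiset.count_nsmul, Multiset.count_dedup]
    split_ifs with hp
    · have hcount :=
        UniqueFactorizationMonoid.emultiplicity_eq_count_normalizedFactors (hirr p hp) hf
      rw [UniqueFactorizationMonoid.normalize_normalized_factor p hp] at hcount
      obtain ⟨⟨q, hq⟩, hnd⟩ := emultiplicity_eq_coe.1 hcount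
      rw [mul_one]
      refine h p q _ (hirr p hp) (Multiset.count_ne_zero.2 hp) (fun hpq => hnd ?_) hq
      rw [pow_succ]
      exact (mul_dvd_mul_left _ hpq).trans (dvd_of_eq hq.symm)
    · rw [Multiset.count_eq_zero_of_notMem hp, mul_zero]
  refine ⟨s.dedup.prod, ?_, ?_⟩
  · have hirr' : ∀ p ∈ s.dedup, Irreducible p := fun p hp => hirr p (Multiset.mem_dedup.1 hp)
    have : Nontrivial R := ⟨f, 0, hf⟩
    have h0 : s.dedup.prod ≠ 0 := fun h0 => (hirr' 0 (Multiset.prod_eq_zero_iff.1 h0)).ne_zero rfl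
    rw [UniqueFactorizationMonoid.squarefree_iff_nodup_normalizedFactors h0,
      UniqueFactorizationMonoid.normalizedFactors_prod_eq _ hirr',
      Multiset.map_congr rfl (fun p hp =>
        UniqueFactorizationMonoid.normalize_normalized_factor p (Multiset.mem_dedup.1 hp)),
      Multiset.map_id']
    exact s.nodup_dedup
  · rw [← Multiset.prod_nsmul, ← hsm]
    exact UniqueFactorizationMonoid.prod_normalizedFactors hf

/-- Units of `ℂ[X][Y]` are nonzero constants, which have `m`-th roots. -/
theorem exists_pow_eq_of_associated {m : ℕ} (hm : m ≠ 0) {f g : ℂ[X][Y]}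
    (h : Associated (g ^ m) f) : ∃ c : ℂ[X][Y], IsUnit c ∧ f = (g * c) ^ m := by
  obtain ⟨u, rfl⟩ := h
  obtain ⟨r, hr, hru⟩ := isUnit_iff.1 u.isUnit
  obtain ⟨c, hc, rfl⟩ := isUnit_iff.1 hr
  obtain ⟨z, hz⟩ := IsAlgClosed.exists_pow_nat_eq c (Nat.pos_of_ne_zero hm)
  have hz0 : IsUnit z := (isUnit_pow_iff hm).1 (hz ▸ hc)
  exact ⟨C (C z), (hz0.map C).map C, by rw [mul_pow, ← C_pow, ← C_pow, hz, hru]⟩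

theorem IsMapOfTuples.exists_squarefree_pow {d : ℕ} (hd : d ≠ 0) {f : ℂ[X][Y]}
    (hf : IsMapOfTuples d f) :
    ∃ (m : ℕ) (g : ℂ[X][Y]), m ≠ 0 ∧ Squarefree g ∧ f = g ^ m := by
  have hu : ¬ IsUnit f := fun hu => hd (hf.natDegree_eq.symm.trans (natDegree_eq_zero_of_isUnit hu))
  obtain ⟨p, hp, hpf⟩ := WfDvdMonoid.exists_irreducible_factor hu hf.ne_zero
  have hfin : FiniteMultiplicity p f := FiniteMultiplicity.of_prime_left hp.prime hf.ne_zero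
  obtain ⟨q, hfq, hq⟩ := hfin.exists_eq_pow_mul_and_not_dvd
  have hm : multiplicity p f ≠ 0 := fun h0 => by
    rw [h0, pow_zero, one_mul] at hfq
    exact hq (hfq ▸ hpf)
  obtain ⟨g, hg, hgf⟩ := exists_squarefree_pow_associated hf.ne_zero
    fun p' q' n hp' hn hq' h' => hf.multiplicity_eq hp' hn hq' h' hp hm hq hfq
  obtain ⟨c, hc, hfc⟩ := exists_pow_eq_of_associated hm hgf
  exact ⟨_, _, hm, (associated_mul_unit_right g c hc).squarefree_iff.1 hg, hfc⟩

/-! ### Roots of maps of tuples, and squarefreeness -/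

theorem zeros_pow {m k : ℕ} (p : ℂ[X]) :
    zeros (m * k) (p ^ m) = m • zeros k p := by
  simp only [zeros, roots_pow, natDegree_pow, nsmul_add, Multiset.map_nsmul, ← Nat.mul_sub,
    Multiset.nsmul_replicate]

theorem nsmul_multiset_injective {α : Type*} {m : ℕ} (hm : m ≠ 0) {s t : Multiset α}
    (h : m • s = m • t) : s = t := by
  classical
  ext a
  have := congrArg (Multiset.count a) h
  rw [Multiset.count_nsmul, Multiset.count_nsmul] at this
  exact Nat.eq_of_mul_eq_mul_left (Nat.pos_of_ne_zero hm) this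

theorem sectionY_pow {m k : ℕ} {g : ℂ[X][Y]} (h : g.natDegree ≤ k) (b : OnePoint ℂ) :
    sectionY (m * k) (g ^ m) b = sectionY k g b ^ m := by
  cases b with
  | infty => exact coeff_pow_of_natDegree_le h
  | coe b => exact eval_pow m

theorem sectionX_pow {m k : ℕ} {g : ℂ[X][Y]} (hy : g.natDegree ≤ k)
    (hx : ∀ j, (g.coeff j).natDegree ≤ k) (a : OnePoint ℂ) :
    sectionX (m * k) (g ^ m) a = sectionX k g a ^ m := by
  cases a with
  | infty =>
    refine (sectionX_infty (natDegree_pow_le_of_le m hy)).trans ?_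
    rw [map_pow, coeff_pow_of_natDegree_le (natDegree_swap_le hx)]
    exact congrArg (· ^ m) (sectionX_infty hy).symm
  | coe a => exact Polynomial.map_pow _ m

/-- Every fibre of `g ^ m` is `m` copies of the corresponding fibre of `g`, and `m` can be cancelled
in equalities of multisets. -/
theorem IsMapOfTuples.of_pow {m k : ℕ} (hm : m ≠ 0) {g : ℂ[X][Y]}
    (hf : IsMapOfTuples (m * k) (g ^ m)) : IsMapOfTuples k g := by
  have hm' := Nat.pos_of_ne_zero hm
  have hy : g.natDegree = k := by
    have := hf.natDegree_eq
    rw [natDegree_pow] at this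
    exact Nat.eq_of_mul_eq_mul_left hm' this
  have hx' : (Bivariate.swap g).natDegree = k := by
    have := hf.swap.natDegree_eq
    rw [map_pow, natDegree_pow] at this
    exact Nat.eq_of_mul_eq_mul_left hm' this
  have hx : ∀ j, (g.coeff j).natDegree ≤ k := fun j => by
    rw [← Bivariate.swap_swap_apply g]
    exact natDegree_coeff_swap_le hx'.le j
  have him : ∀ x, image (m * k) (g ^ m) x = m • image k g x := fun x => by
    rw [image, sectionX_pow hy.le hx, zeros_pow, image]
  have hpre : ∀ y, preimage (m * k) (g ^ m) y = m • preimage k g y := fun y => by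
    rw [preimage, sectionY_pow hy.le, zeros_pow, preimage]
  refine ⟨⟨hy.le, hx, fun a h0 => ?_, fun b h0 => ?_⟩, fun x y hyx y' hyx' => ?_,
    fun y x hxy x' hxy' => ?_⟩
  · exact hf.sectionX_ne_zero a (by rw [sectionX_pow hy.le hx, h0, zero_pow hm])
  · exact hf.sectionY_ne_zero b (by rw [sectionY_pow hy.le, h0, zero_pow hm])
  · refine nsmul_multiset_injective hm ?_
    rw [← hpre, ← hpre]
    refine hf.preimage_eq x y ?_ y' ?_ <;> rw [him, Multiset.mem_nsmul] <;> exact ⟨hm, ‹_›⟩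
  · refine nsmul_multiset_injective hm ?_
    rw [← him, ← him]
    refine hf.image_eq y x ?_ x' ?_ <;> rw [hpre, Multiset.mem_nsmul] <;> exact ⟨hm, ‹_›⟩

theorem IsMapOfTuples.squarefree {d : ℕ} (hd : d ≠ 0) {f : ℂ[X][Y]}
    (hf : IsMapOfTuples d f) (hpow : ¬ IsProperPower d f) : Squarefree f := by
  obtain ⟨m, g, hm, hg, rfl⟩ := hf.exists_squarefree_pow hd
  have hdeg : d = m * g.natDegree := by rw [← natDegree_pow, hf.natDegree_eq]
  have hk : g.natDegree ≠ 0 := fun h0 => hd (by rw [hdeg, h0, mul_zero])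
  rcases eq_or_ne m 1 with rfl | hm1
  · rwa [pow_one]
  refine absurd ⟨g.natDegree, g, ⟨m, by rw [hdeg, mul_comm]⟩, fun h => hm1 ?_,
    (hdeg ▸ hf).of_pow hm, ?_⟩ hpow
  · exact Nat.eq_of_mul_eq_mul_right (Nat.pos_of_ne_zero hk) (by rw [one_mul, ← hdeg, h])
  · rw [hdeg, Nat.mul_div_cancel _ (Nat.pos_of_ne_zero hk)]

theorem IsMapOfTuples.eventually_separable_sectionX {d : ℕ} (hd : d ≠ 0) {f : ℂ[X][Y]}
    (hf : IsMapOfTuples d f) (hpow : ¬ IsProperPower d f) :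
    ∀ᶠ x : ℂ in cofinite, (sectionX d f x).Separable ∧ (sectionX d f x).natDegree = d := by
  filter_upwards [eventually_separable hf.isPrimitive (hf.squarefree hd hpow),
    eventually_natDegree_map hf.ne_zero] with x hx hx'
  exact ⟨hx, hx'.trans hf.natDegree_eq⟩

theorem IsMapOfTuples.eventually_separable_sectionY {d : ℕ} (hd : d ≠ 0) {f : ℂ[X][Y]}
    (hf : IsMapOfTuples d f) (hpow : ¬ IsProperPower d f) :
    ∀ᶠ y : ℂ in cofinite, (sectionY d f y).Separable ∧ (sectionY d f y).natDegree = d := by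
  have hs : Squarefree (Bivariate.swap f) := fun p hp => by
    refine (MulEquiv.isUnit_map (Bivariate.swap (R := ℂ))).1 (hf.squarefree hd hpow _ ?_)
    rw [← map_mul, ← map_dvd_iff (Bivariate.swap (R := ℂ)), Bivariate.swap_swap_apply]
    exact hp
  filter_upwards [eventually_separable hf.swap.isPrimitive hs,
    eventually_natDegree_map hf.swap.ne_zero] with y hy hy'
  rw [← sectionX_swap hf.natDegree_x_le]
  exact ⟨hy, hy'.trans hf.swap.natDegree_eq⟩

/-! ### Determination of the polynomial by its affine zero set -/

theorem exists_eq_C_mul_of_dvd {p q : ℂ[X]} (hp : p ≠ 0) (h : p ∣ q)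
    (hd : q.natDegree ≤ p.natDegree) : ∃ c : ℂ, q = C c * p := by
  obtain ⟨r, rfl⟩ := h
  rcases eq_or_ne r 0 with rfl | hr
  · exact ⟨0, by simp⟩
  rw [natDegree_mul hp hr] at hd
  have hr0 : r.natDegree = 0 := by lia
  exact ⟨r.coeff 0, by rw [← eq_C_of_natDegree_eq_zero hr0, mul_comm]⟩

theorem exists_eq_C_mul_of_separable {p q : ℂ[X]} (hp : p.Separable)
    (hd : q.natDegree ≤ p.natDegree) (h : ∀ a, p.eval a = 0 → q.eval a = 0) :
    ∃ c : ℂ, q = C c * p := by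
  rcases eq_or_ne q 0 with rfl | hq
  · exact ⟨0, by simp⟩
  refine exists_eq_C_mul_of_dvd hp.ne_zero ?_ hd
  rw [IsAlgClosed.dvd_iff_roots_le_roots hp.ne_zero hq,
    Multiset.le_iff_subset (nodup_roots hp)]
  intro a ha
  exact (mem_roots hq).2 (h a ((mem_roots hp.ne_zero).1 ha))

theorem exists_eq_C_mul_of_zeros_eq {d : ℕ} {p q : ℂ[X]} (hp : p ≠ 0) (hq : q ≠ 0)
    (h : zeros d q = zeros d p) : ∃ c : ℂ, q = C c * p := by
  classical
  have hr : p.roots = q.roots := by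
    ext a
    rw [count_roots, count_roots, ← count_coe_zeros d, ← count_coe_zeros d, h]
  obtain ⟨u, rfl⟩ := (IsAlgClosed.associated_iff_roots_eq_roots hp hq).2 hr
  obtain ⟨c, -, hc⟩ := isUnit_iff.1 u.isUnit
  exact ⟨c, by rw [hc, mul_comm]⟩

/-- A correspondence is determined up to a constant by its affine zero set, when it is a map of
tuples and not a proper power. -/
theorem IsMapOfTuples.exists_eq_C_mul {d : ℕ} (hd : d ≠ 0) {f g : ℂ[X][Y]}
    (hf : IsMapOfTuples d f) (hpow : ¬ IsProperPower d f) (hy : g.natDegree ≤ d)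
    (hx : ∀ j, (g.coeff j).natDegree ≤ d)
    (h : ∀ x y, f.evalEval x y = 0 → g.evalEval x y = 0) : ∃ c : ℂ, g = C (C c) * f := by
  obtain ⟨y₀, hsep, hdeg⟩ := (hf.eventually_separable_sectionY hd hpow).exists
  have hdg : (g.eval (C y₀)).natDegree ≤ d := by
    rw [← sectionX_swap hf.natDegree_x_le] at hdeg
    have := sectionX_swap hx y₀
    change (Bivariate.swap g).map (evalRingHom y₀) = g.eval (C y₀) at this
    rw [← this]
    exact natDegree_map_le.trans (natDegree_swap_le hx)
  obtain ⟨c, hc⟩ := exists_eq_C_mul_of_separable hsep (hdg.trans hdeg.ge) fun x => h x y₀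
  refine ⟨c, ext_evalEval ?_⟩
  filter_upwards [hf.eventually_separable_sectionX hd hpow, eventually_eval_ne_zero hsep.ne_zero]
    with x hxs hx0 y
  obtain ⟨b, hb⟩ := exists_eq_C_mul_of_separable hxs.1
    ((natDegree_map_le.trans hy).trans hxs.2.ge : (g.map (evalRingHom x)).natDegree ≤ _)
    fun y hxy => by
      rw [map_evalRingHom_eval]
      exact h x y (by rw [← map_evalRingHom_eval]; exact hxy)
  have hby : ∀ y, g.evalEval x y = b * f.evalEval x y := fun y => by
    rw [← map_evalRingHom_eval, hb, eval_mul, eval_C, ← map_evalRingHom_eval]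
    rfl
  have hcx : g.evalEval x y₀ = c * f.evalEval x y₀ := by
    rw [evalEval, hc, eval_mul, eval_C]
    rfl
  -- The factor `b` a priori depends on `x`; the horizontal section at `y₀` ties all of them to the
  -- single constant `c`.
  have hbc : b = c := mul_right_cancel₀ hx0 ((hby y₀).symm.trans hcx)
  rw [hby, hbc, evalEval_mul, evalEval_CC]

/-! ### Proportional sections and the interpolation identity -/

theorem IsCorrespondence.natDegree_sectionY_le {d : ℕ} {f : ℂ[X][Y]}
    (hf : IsCorrespondence d f) (b : ℂ) : (sectionY d f b).natDegree ≤ d := by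
  rw [← sectionX_swap hf.natDegree_x_le]
  exact natDegree_map_le.trans (natDegree_swap_le hf.natDegree_x_le)

theorem IsCorrespondence.natDegree_sectionX_le {d : ℕ} {f : ℂ[X][Y]}
    (hf : IsCorrespondence d f) (a : ℂ) : (sectionX d f a).natDegree ≤ d :=
  natDegree_map_le.trans hf.natDegree_y_le

/-- Both `x` and `x'` lie in `X(y)`, so `Y(x) = Y(x')` with multiplicities, and a polynomial is
determined up to a constant by its roots. -/
theorem IsMapOfTuples.exists_evalEval_eq_mul {d : ℕ} {f : ℂ[X][Y]} (hf : IsMapOfTuples d f)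
    {x x' y : ℂ} (h : f.evalEval x y = 0) (h' : f.evalEval x' y = 0) :
    ∃ c : ℂ, ∀ z, f.evalEval x' z = c * f.evalEval x z := by
  obtain ⟨c, hc⟩ := exists_eq_C_mul_of_zeros_eq (hf.sectionX_ne_zero x) (hf.sectionX_ne_zero x')
    (hf.image_eq y x' (hf.coe_mem_preimage.2 h') x (hf.coe_mem_preimage.2 h))
  refine ⟨c, fun z => ?_⟩
  have := congrArg (eval z) hc
  rw [eval_mul, eval_C] at this
  rw [← map_evalRingHom_eval, ← map_evalRingHom_eval]
  exact this

theorem IsMapOfTuples.evalEval_eq_zero_of_common {d : ℕ} {f : ℂ[X][Y]} (hf : IsMapOfTuples d f)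
    {x x' y y' : ℂ} (h : f.evalEval x y = 0) (h' : f.evalEval x y' = 0)
    (hx : f.evalEval x' y = 0) : f.evalEval x' y' = 0 := by
  obtain ⟨c, hc⟩ := hf.exists_evalEval_eq_mul h hx
  rw [hc, h', mul_zero]

/-- A map of tuples is determined by two generic horizontal sections and two vertical ones. -/
theorem IsMapOfTuples.evalEval_mul_eq {d : ℕ} (hd : d ≠ 0) {f : ℂ[X][Y]}
    (hf : IsMapOfTuples d f) {x₁ x₂ y₁ y₂ : ℂ}
    (hs₁ : (sectionY d f y₁).Separable) (hd₁ : (sectionY d f y₁).natDegree = d)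
    (hs₂ : (sectionY d f y₂).Separable) (hd₂ : (sectionY d f y₂).natDegree = d)
    (h₁ : f.evalEval x₁ y₁ = 0) (h₂ : f.evalEval x₂ y₂ = 0) (h₁₂ : f.evalEval x₁ y₂ ≠ 0)
    (x y : ℂ) :
    f.evalEval x y * f.evalEval x₂ y₁ * f.evalEval x₁ y₂ =
      f.evalEval x y₁ * f.evalEval x₂ y * f.evalEval x₁ y₂ +
        f.evalEval x y₂ * f.evalEval x₁ y * f.evalEval x₂ y₁ := by
  classical
  set p : ℂ[X] := C (f.evalEval x₂ y₁ * f.evalEval x₁ y₂) * sectionY d f y -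
    C (f.evalEval x₂ y * f.evalEval x₁ y₂) * sectionY d f y₁ -
    C (f.evalEval x₁ y * f.evalEval x₂ y₁) * sectionY d f y₂ with hp
  have hpe : ∀ z, p.eval z = f.evalEval x₂ y₁ * f.evalEval x₁ y₂ * f.evalEval z y -
      f.evalEval x₂ y * f.evalEval x₁ y₂ * f.evalEval z y₁ -
      f.evalEval x₁ y * f.evalEval x₂ y₁ * f.evalEval z y₂ := fun z => by
    rw [hp, eval_sub, eval_sub, eval_mul, eval_mul, eval_mul, eval_C, eval_C, eval_C]
    rfl
  have hpd : p.natDegree ≤ d :=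
    (natDegree_sub_le _ _).trans (max_le ((natDegree_sub_le _ _).trans (max_le
      ((natDegree_C_mul_le _ _).trans (hf.natDegree_sectionY_le y))
      ((natDegree_C_mul_le _ _).trans (hf.natDegree_sectionY_le y₁))))
      ((natDegree_C_mul_le _ _).trans (hf.natDegree_sectionY_le y₂)))
  have hcard : ∀ q : ℂ[X], q.Separable → q.natDegree = d → q.roots.toFinset.card = d :=
    fun q hq hqd => by
      rw [Multiset.toFinset_card_of_nodup (nodup_roots hq),
        ← (IsAlgClosed.splits q).natDegree_eq_card_roots, hqd]
  have hmem₁ : ∀ z ∈ (sectionY d f y₁).roots.toFinset, f.evalEval z y₁ = 0 := fun z hz =>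
    (mem_roots hs₁.ne_zero).1 (Multiset.mem_toFinset.1 hz)
  have hmem₂ : ∀ z ∈ (sectionY d f y₂).roots.toFinset, f.evalEval z y₂ = 0 := fun z hz =>
    (mem_roots hs₂.ne_zero).1 (Multiset.mem_toFinset.1 hz)
  have hdisj : Disjoint (sectionY d f y₁).roots.toFinset (sectionY d f y₂).roots.toFinset :=
    Finset.disjoint_left.2 fun z hz hz' =>
      h₁₂ (hf.evalEval_eq_zero_of_common (hmem₁ z hz) (hmem₂ z hz') h₁)
  -- The polynomial `p` has degree at most `d` but vanishes on two disjoint fibres of `d` points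
  -- each. On the fibre of `y₁` its sections are proportional to that of `x₁`, on the fibre of `y₂`
  -- to that of `x₂`.
  have hp0 : p = 0 := by
    refine eq_zero_of_natDegree_lt_card_of_eval_eq_zero' p
      ((sectionY d f y₁).roots.toFinset ∪ (sectionY d f y₂).roots.toFinset) ?_ ?_
    · intro z hz
      rw [hpe]
      rcases Finset.mem_union.1 hz with hz | hz
      · obtain ⟨c, hc⟩ := hf.exists_evalEval_eq_mul h₁ (hmem₁ z hz)
        rw [hmem₁ z hz, hc, hc]
        ring
      · obtain ⟨c, hc⟩ := hf.exists_evalEval_eq_mul h₂ (hmem₂ z hz)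
        rw [hmem₂ z hz, hc, hc]
        ring
    · rw [Finset.card_union_of_disjoint hdisj, hcard _ hs₁ hd₁, hcard _ hs₂ hd₂]
      lia
  have := hpe x
  rw [hp0, eval_zero] at this
  linear_combination -this

/-! ### Separated forms and fractions on the sphere -/

theorem formEval_C_mul (d : ℕ) (c : ℂ) (p : ℂ[X]) (x : OnePoint ℂ) :
    formEval d (C c * p) x = c * formEval d p x := by
  cases x with
  | infty => exact coeff_C_mul p
  | coe a => exact (eval_mul ..).trans (by rw [eval_C]; rfl)

theorem formEval_sub (d : ℕ) (p q : ℂ[X]) (x : OnePoint ℂ) :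
    formEval d (p - q) x = formEval d p x - formEval d q x := by
  cases x with
  | infty => exact coeff_sub p q d
  | coe a => exact eval_sub ..

theorem fracMap_eq_fracMap_iff {d : ℕ} {K L M N : ℂ[X]} {x y : OnePoint ℂ}
    (h : ¬ (formEval d K x = 0 ∧ formEval d L x = 0))
    (h' : ¬ (formEval d M y = 0 ∧ formEval d N y = 0)) :
    fracMap d K L x = fracMap d M N y ↔
      formEval d K x * formEval d N y = formEval d L x * formEval d M y := by
  unfold fracMap
  by_cases hL : formEval d L x = 0 <;> by_cases hN : formEval d N y = 0
  · simp [hL, hN]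
  · simp_all
  · simp_all
  · rw [if_neg hL, if_neg hN, OnePoint.coe_eq_coe, div_eq_div_iff hL hN, mul_comm (formEval d M y)]

/-- Finite points give coprimality; the point `∞` gives a nonzero coefficient of degree `d`. -/
theorem isFractionOfDegree_of_formEval {d : ℕ} {P Q : ℂ[X]} (hP : P.natDegree ≤ d)
    (hQ : Q.natDegree ≤ d)
    (h : ∀ x, ¬ (formEval d P x = 0 ∧ formEval d Q x = 0)) : IsFractionOfDegree d P Q := by
  refine ⟨(isCoprime_iff_aeval_ne_zero_of_isAlgClosed ℂ ℂ P Q).2 fun a => ?_,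
    le_antisymm (max_le hP hQ) ?_⟩
  · rw [← not_and_or]
    exact h a
  · by_cases h0 : P.coeff d = 0
    · exact (le_natDegree_of_ne_zero fun h1 => h none ⟨h0, h1⟩).trans (le_max_right _ _)
    · exact (le_natDegree_of_ne_zero h0).trans (le_max_left _ _)

theorem sectionX_separated {d : ℕ} {K L M N : ℂ[X]} {c : ℂ} (hM : M.natDegree ≤ d)
    (hN : N.natDegree ≤ d) (x : OnePoint ℂ) :
    sectionX d (C (C c) * (C K * N.map C - C L * M.map C)) x =
      C c * (C (formEval d K x) * N - C (formEval d L x) * M) := by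
  cases x with
  | infty =>
    have hle : (C (C c) * (C K * N.map C - C L * M.map C)).natDegree ≤ d :=
      (natDegree_C_mul_le _ _).trans ((natDegree_sub_le _ _).trans (max_le
        ((natDegree_C_mul_le _ _).trans (natDegree_map_le.trans hN))
        ((natDegree_C_mul_le _ _).trans (natDegree_map_le.trans hM))))
    refine (sectionX_infty hle).trans ?_
    ext i
    rw [coeff_coeff_swap]
    simp [coeff_C_mul, coeff_sub, formEval, coeff_mul_C]
  | coe a =>
    change (C (C c) * (C K * N.map C - C L * M.map C)).map (evalRingHom a) = _
    have hC : (evalRingHom a).comp C = RingHom.id ℂ := by ext; simp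
    simp [Polynomial.map_map, hC, formEval]

theorem sectionY_separated {d : ℕ} {K L M N : ℂ[X]} {c : ℂ} (y : OnePoint ℂ) :
    sectionY d (C (C c) * (C K * N.map C - C L * M.map C)) y =
      C c * (C (formEval d N y) * K - C (formEval d M y) * L) := by
  cases y with
  | infty => simp [sectionY, formEval, mul_comm]
  | coe b => simp [sectionY, formEval, mul_comm]

/-- A common zero of `K` and `L`, or of `M` and `N`, even at `∞`, would give a vertical or
horizontal component. -/
theorem IsCorrespondence.isSeparation {d : ℕ} {K L M N : ℂ[X]} {c : ℂ}
    (hK : K.natDegree ≤ d) (hL : L.natDegree ≤ d) (hM : M.natDegree ≤ d) (hN : N.natDegree ≤ d)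
    (hf : IsCorrespondence d (C (C c) * (C K * N.map C - C L * M.map C))) :
    IsSeparation d (C (C c) * (C K * N.map C - C L * M.map C)) K L M N := by
  have hc : c ≠ 0 := by
    rintro rfl
    exact hf.ne_zero (by simp)
  have hKL : ∀ x, ¬ (formEval d K x = 0 ∧ formEval d L x = 0) := fun x ⟨h, h'⟩ =>
    hf.sectionX_ne_zero x (by rw [sectionX_separated hM hN, h, h']; simp)
  have hMN : ∀ y, ¬ (formEval d M y = 0 ∧ formEval d N y = 0) := fun y ⟨h, h'⟩ =>
    hf.sectionY_ne_zero y (by rw [sectionY_separated, h, h']; simp)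
  refine ⟨isFractionOfDegree_of_formEval hK hL hKL, isFractionOfDegree_of_formEval hM hN hMN,
    fun x y => ?_⟩
  rw [fracMap_eq_fracMap_iff (hKL x) (hMN y)]
  change formEval d (sectionX d _ x) y = 0 ↔ _
  rw [sectionX_separated hM hN, formEval_C_mul, formEval_sub, formEval_C_mul, formEval_C_mul,
    mul_eq_zero_iff_left hc, sub_eq_zero]

/-! ### Reality of the coefficients -/

theorem hasRealCoeffs_iff {p : ℂ[X]} : HasRealCoeffs p ↔ p.map (starRingEnd ℂ) = p := by
  simp only [HasRealCoeffs, Polynomial.ext_iff, coeff_map, Complex.conj_eq_iff_im]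

theorem HasRealCoeffs.eval_conj {p : ℂ[X]} (hp : HasRealCoeffs p) (x : ℂ) :
    p.eval (conj x) = conj (p.eval x) := by
  conv_lhs => rw [← hasRealCoeffs_iff.1 hp]
  exact eval_map_apply ..

theorem evalEval_map_conj (f : ℂ[X][Y]) (x y : ℂ) :
    (f.map (mapRingHom (starRingEnd ℂ))).evalEval x y = conj (f.evalEval (conj x) (conj y)) := by
  rw [← map_mapRingHom_evalEval, Complex.conj_conj, Complex.conj_conj]

/-- A polynomial proportional to its conjugate has real coefficients up to a constant. -/
theorem exists_real_of_map_conj_eq {d : ℕ} {f : ℂ[X][Y]} (hf : IsCorrespondence d f) {c : ℂ}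
    (h : f.map (mapRingHom (starRingEnd ℂ)) = C (C c) * f) :
    ∃ (a : ℂ) (B : Matrix (Fin (d + 1)) (Fin (d + 1)) ℝ), a ≠ 0 ∧
      coeffMatrix d f = a • B.map (fun r : ℝ => (r : ℂ)) := by
  have hcoeff : ∀ i j, conj ((f.coeff j).coeff i) = c * (f.coeff j).coeff i := fun i j => by
    have := congrArg (fun p => (p.coeff j).coeff i) h
    simpa [coeff_C_mul] using this
  -- Any nonzero coefficient would do: conjugation multiplies all coefficients by the same `c`, so
  -- their ratios to `a` are real.
  set a := (f.coeff d).leadingCoeff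
  have ha : a ≠ 0 := leadingCoeff_ne_zero.2 (hf.sectionY_ne_zero none)
  have hca : conj a = c * a := hcoeff _ _
  have hc : c ≠ 0 := by
    rintro rfl
    rw [zero_mul, map_eq_zero] at hca
    exact ha hca
  refine ⟨a, .of fun i j => (coeffMatrix d f i j / a).re, ha, ?_⟩
  ext i j
  have hreal : conj (coeffMatrix d f i j / a) = coeffMatrix d f i j / a := by
    rw [map_div₀, hca, coeffMatrix, hcoeff, mul_div_mul_left _ _ hc]
  rw [Matrix.smul_apply, Matrix.map_apply, Matrix.of_apply, Complex.conj_eq_iff_re.1 hreal,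
    smul_eq_mul, mul_div_cancel₀ _ ha]

theorem map_conj_eq_of_coeffMatrix {d : ℕ} {f : ℂ[X][Y]} (hf : IsCorrespondence d f) {a : ℂ}
    (ha : a ≠ 0) {B : Matrix (Fin (d + 1)) (Fin (d + 1)) ℝ}
    (h : coeffMatrix d f = a • B.map (fun r : ℝ => (r : ℂ))) :
    (C (C a⁻¹) * f).map (mapRingHom (starRingEnd ℂ)) = C (C a⁻¹) * f := by
  ext j i
  rw [coeff_map, coe_mapRingHom, coeff_map, coeff_C_mul, coeff_C_mul]
  rcases lt_or_ge d j with hj | hj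
  · rw [coeff_eq_zero_of_natDegree_lt (hf.natDegree_y_le.trans_lt hj)]
    simp
  rcases lt_or_ge d i with hi | hi
  · rw [coeff_eq_zero_of_natDegree_lt ((hf.natDegree_x_le j).trans_lt hi)]
    simp
  have := congrFun (congrFun h ⟨d - i, by lia⟩) ⟨d - j, by lia⟩
  simp only [coeffMatrix, Nat.sub_sub_self hi, Nat.sub_sub_self hj, Matrix.smul_apply,
    Matrix.map_apply, smul_eq_mul] at this
  rw [this, inv_mul_cancel_left₀ ha, Complex.conj_ofReal]

theorem eq_of_separated_eq {K L M N M' N' : ℂ[X]} {x : ℂ} (hK : K.eval x = 0) (hL : L.eval x ≠ 0)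
    (h : C K * N.map C - C L * M.map C = C K * N'.map C - C L * M'.map C) : M = M' := by
  refine Polynomial.funext fun y => ?_
  have := congrArg (evalEval x y) h
  simp only [evalEval_sub, evalEval_mul, evalEval_C, evalEval_map_C, hK, zero_mul, zero_sub,
    neg_inj] at this
  exact mul_left_cancel₀ hL this

/-- The coefficients of the factors in a separated form are real when the form is real and its
factors in one of the variables are. -/
theorem hasRealCoeffs_of_separated {K L M N : ℂ[X]} (hK : HasRealCoeffs K) (hL : HasRealCoeffs L)
    {x₁ x₂ : ℂ} (hK₁ : K.eval x₁ = 0) (hL₁ : L.eval x₁ ≠ 0) (hK₂ : K.eval x₂ ≠ 0)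
    (hL₂ : L.eval x₂ = 0)
    (h : (C K * N.map C - C L * M.map C).map (mapRingHom (starRingEnd ℂ)) =
      C K * N.map C - C L * M.map C) : HasRealCoeffs M ∧ HasRealCoeffs N := by
  have hC : (mapRingHom (starRingEnd ℂ)).comp C = C.comp (starRingEnd ℂ) := by
    ext; simp
  simp only [Polynomial.map_sub, Polynomial.map_mul, map_C, coe_mapRingHom, hasRealCoeffs_iff.1 hK,
    hasRealCoeffs_iff.1 hL, Polynomial.map_map, hC] at h
  simp only [← Polynomial.map_map] at h
  refine ⟨hasRealCoeffs_iff.2 (eq_of_separated_eq hK₁ hL₁ h), hasRealCoeffs_iff.2 ?_⟩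
  -- Negating the relation exchanges the roles of `K` and `L`, and of `M` and `N`.
  refine eq_of_separated_eq hL₂ hK₂ (N := M.map (starRingEnd ℂ)) (N' := M) ?_
  linear_combination -h

theorem IsMapOfTuples.exists_real_separation {d : ℕ} (hd : d ≠ 0) {f : ℂ[X][Y]}
    (hf : IsMapOfTuples d f) (hpow : ¬ IsProperPower d f) {a : ℂ} (ha : a ≠ 0)
    (hreal : (C (C a⁻¹) * f).map (mapRingHom (starRingEnd ℂ)) = C (C a⁻¹) * f) :
    ∃ K L M N : ℂ[X], IsSeparation d f K L M N ∧
      HasRealCoeffs K ∧ HasRealCoeffs L ∧ HasRealCoeffs M ∧ HasRealCoeffs N := by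
  -- Only finitely many `y` are bad, so generic `y₁`, `y₂` can be taken real; `x₁`, `x₂` may still
  -- be non-real.
  have hgen : ∀ᶠ y : ℝ in cofinite, (sectionY d f (y : ℂ)).Separable ∧
      (sectionY d f (y : ℂ)).natDegree = d :=
    Complex.ofReal_injective.tendsto_cofinite.eventually
      (hf.eventually_separable_sectionY hd hpow)
  obtain ⟨y₁, hs₁, hd₁⟩ := hgen.exists
  have hroot : ∀ y : ℂ, (sectionY d f y).natDegree = d → ∃ x, f.evalEval x y = 0 := fun y hy =>
    IsAlgClosed.exists_root _ fun h0 => hd (hy.symm.trans (natDegree_eq_of_degree_eq_some h0))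
  obtain ⟨x₁, h₁⟩ := hroot y₁ hd₁
  -- Avoiding the roots of `f(x₁, ·)` makes the fibres of `y₁` and `y₂` disjoint.
  obtain ⟨y₂, ⟨hs₂, hd₂⟩, h₁₂⟩ := (hgen.and (Complex.ofReal_injective.tendsto_cofinite.eventually
    (eventually_eval_ne_zero (hf.sectionX_ne_zero x₁)))).exists
  replace h₁₂ : f.evalEval x₁ y₂ ≠ 0 := by rwa [← map_evalRingHom_eval]
  obtain ⟨x₂, h₂⟩ := hroot y₂ hd₂
  have h₂₁ : f.evalEval x₂ y₁ ≠ 0 := fun h0 => h₁₂ (hf.evalEval_eq_zero_of_common h0 h₂ h₁)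
  have hKreal : ∀ y : ℝ, HasRealCoeffs (C a⁻¹ * sectionY d f (y : ℂ)) := fun y => by
    have := map_mapRingHom_eval_map (starRingEnd ℂ) (C (C a⁻¹) * f) (C (y : ℂ))
    rw [hreal, map_C, Complex.conj_ofReal, eval_mul, eval_C] at this
    exact hasRealCoeffs_iff.2 this.symm
  set K := C a⁻¹ * sectionY d f (y₁ : ℂ) with hK
  set L := C a⁻¹ * sectionY d f (y₂ : ℂ) with hL
  set M := C (-(f.evalEval x₁ y₂)⁻¹) * sectionX d f x₁ with hM
  set N := C ((f.evalEval x₂ y₁)⁻¹) * sectionX d f x₂ with hN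
  have hKe : ∀ x, K.eval x = a⁻¹ * f.evalEval x y₁ := fun x => by rw [hK, eval_mul, eval_C]; rfl
  have hLe : ∀ x, L.eval x = a⁻¹ * f.evalEval x y₂ := fun x => by rw [hL, eval_mul, eval_C]; rfl
  have hMe : ∀ y, M.eval y = -(f.evalEval x₁ y₂)⁻¹ * f.evalEval x₁ y := fun y => by
    rw [hM, eval_mul, eval_C, ← map_evalRingHom_eval x₁ y]; rfl
  have hNe : ∀ y, N.eval y = (f.evalEval x₂ y₁)⁻¹ * f.evalEval x₂ y := fun y => by
    rw [hN, eval_mul, eval_C, ← map_evalRingHom_eval x₂ y]; rfl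
  have hsep : f = C (C a) * (C K * N.map C - C L * M.map C) := by
    refine ext_evalEval (Eventually.of_forall fun x y => ?_)
    have := hf.evalEval_mul_eq hd hs₁ hd₁ hs₂ hd₂ h₁ h₂ h₁₂ x y
    simp only [evalEval_mul, evalEval_sub, evalEval_C, evalEval_map_C, hKe, hLe, hMe, hNe, eval_C]
    field_simp
    linear_combination this
  have hg : C (C a⁻¹) * f = C K * N.map C - C L * M.map C := by
    rw [hsep, ← mul_assoc, ← C_mul, ← C_mul, inv_mul_cancel₀ ha, C_1, C_1, one_mul]
  -- Since `x₁`, `x₂` need not be real, reality of `M` and `N` comes from conjugating the separated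
  -- form and evaluating at `x₁`, where `K` vanishes, and at `x₂`, where `L` does.
  obtain ⟨hMr, hNr⟩ := hasRealCoeffs_of_separated (hKreal y₁) (hKreal y₂) (x₁ := x₁) (x₂ := x₂)
    (N := N) (M := M) (by rw [← hK, hKe, h₁, mul_zero])
    (by rw [← hL, hLe]; exact mul_ne_zero (inv_ne_zero ha) h₁₂)
    (by rw [← hK, hKe]; exact mul_ne_zero (inv_ne_zero ha) h₂₁)
    (by rw [← hL, hLe, h₂, mul_zero]) (by rw [← hK, ← hL, ← hg, hreal])
  refine ⟨K, L, M, N, ?_, hKreal y₁, hKreal y₂, hMr, hNr⟩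
  have hcor := hf.toIsCorrespondence
  rw [hsep] at hcor
  have := hcor.isSeparation
    ((natDegree_C_mul_le _ _).trans (hf.natDegree_sectionY_le _))
    ((natDegree_C_mul_le _ _).trans (hf.natDegree_sectionY_le _))
    ((natDegree_C_mul_le _ _).trans (hf.natDegree_sectionX_le _))
    ((natDegree_C_mul_le _ _).trans (hf.natDegree_sectionX_le _))
  rwa [← hsep] at this

theorem IsSeparation.evalEval_eq_zero_iff {d : ℕ} {f : ℂ[X][Y]} {K L M N : ℂ[X]}
    (h : IsSeparation d f K L M N) (x y : ℂ) :
    f.evalEval x y = 0 ↔ K.eval x * N.eval y = L.eval x * M.eval y := by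
  have hne : ∀ {P Q : ℂ[X]}, IsFractionOfDegree d P Q → ∀ z : ℂ,
      ¬ (formEval d P z = 0 ∧ formEval d Q z = 0) := fun hPQ z =>
    not_and_or.2 ((isCoprime_iff_aeval_ne_zero_of_isAlgClosed ℂ ℂ _ _).1 hPQ.1 z)
  have := (h.2.2 x y).trans (fracMap_eq_fracMap_iff (hne h.1 x) (hne h.2.1 y))
  rw [← map_evalRingHom_eval]
  exact this

theorem IsSeparation.evalEval_conj_eq_zero_iff {d : ℕ} {f : ℂ[X][Y]} {K L M N : ℂ[X]}
    (h : IsSeparation d f K L M N) (hK : HasRealCoeffs K) (hL : HasRealCoeffs L)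
    (hM : HasRealCoeffs M) (hN : HasRealCoeffs N) (x y : ℂ) :
    f.evalEval x y = 0 ↔ f.evalEval (conj x) (conj y) = 0 := by
  rw [h.evalEval_eq_zero_iff, h.evalEval_eq_zero_iff, hK.eval_conj, hL.eval_conj, hM.eval_conj,
    hN.eval_conj, ← map_mul, ← map_mul, (starRingEnd ℂ).injective.eq_iff]

theorem IsMapOfTuples.exists_real_of_forall_conj {d : ℕ} (hd : d ≠ 0) {f : ℂ[X][Y]}
    (hf : IsMapOfTuples d f) (hpow : ¬ IsProperPower d f)
    (h : ∀ x y : ℂ, f.evalEval x y = 0 ↔ f.evalEval (conj x) (conj y) = 0) :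
    ∃ (a : ℂ) (B : Matrix (Fin (d + 1)) (Fin (d + 1)) ℝ), a ≠ 0 ∧
      coeffMatrix d f = a • B.map (fun r : ℝ => (r : ℂ)) := by
  obtain ⟨c, hc⟩ := hf.exists_eq_C_mul hd hpow
    (g := f.map (mapRingHom (starRingEnd ℂ))) (natDegree_map_le.trans hf.natDegree_y_le)
    (fun j => by
      rw [coeff_map]
      exact natDegree_map_le.trans (hf.natDegree_x_le j))
    (fun x y hxy => by rw [evalEval_map_conj, (h x y).1 hxy, map_zero])
  exact exists_real_of_map_conj_eq hf.toIsCorrespondence hc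

end TupleMap

theorem theorem2p6 (d : ℕ) (hd : 2 ≤ d) (f : ℂ[X][Y])
    (hf : TupleMap.IsMapOfTuples d f) (hpow : ¬ TupleMap.IsProperPower d f) :
    List.TFAE [
      ∀ x y : ℂ, f.evalEval x y = 0 ↔
        f.evalEval (starRingEnd ℂ x) (starRingEnd ℂ y) = 0,
      ∃ K L M N : Polynomial ℂ, TupleMap.IsSeparation d f K L M N ∧
        TupleMap.HasRealCoeffs K ∧ TupleMap.HasRealCoeffs L ∧
        TupleMap.HasRealCoeffs M ∧ TupleMap.HasRealCoeffs N,
      ∃ (c : ℂ) (B : Matrix (Fin (d + 1)) (Fin (d + 1)) ℝ), c ≠ 0 ∧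
        TupleMap.coeffMatrix d f = c • B.map (fun r : ℝ => (r : ℂ))] := by
  have hd0 : d ≠ 0 := by lia
  tfae_have 1 → 3 := hf.exists_real_of_forall_conj hd0 hpow
  tfae_have 3 → 2 := fun ⟨a, B, ha, hB⟩ => hf.exists_real_separation hd0 hpow ha
    (TupleMap.map_conj_eq_of_coeffMatrix hf.toIsCorrespondence ha hB)
  tfae_have 2 → 1 := fun ⟨K, L, M, N, h, hK, hL, hM, hN⟩ =>
    h.evalEval_conj_eq_zero_iff hK hL hM hN
  tfae_finish
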